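/- Let $C_d>1$. There is a constant $C=C(C_d)>0$, depending only on $C_d$, such that the following holds. Let $(X,d)$ be a complete metric space with a Borel measure $\mu$ that is doubling with constant $C_d$, i.e. $0<\mu(B(x,2r))\le C_d\,\mu(B(x,r))<\infty$ for all $x\in X$, $r>0$, where $B(x,r)$ is the open ball. Suppose that $\mu$ satisfies an annular decay property: for some $0\le\alpha\le1$ and $K\ge1$, $$\mu\big(B(x,r)\setminus B(x,(1-\delta)r)\big)\le K\delta^{\alpha}\mu(B(x,r))\qquad\text{for all }x\in X,\ r>0,\ 0<\delta<1.$$ Let $L^1_{\mathrm{loc}}(X)$ be the set of real functions integrable on every compact subset of $X$, and write $f_B=\mu(B)^{-1}\int_B f\,d\mu$. For $f\in L^1_{\mathrm{loc}}(X)$ put $$\|f\|_{BMO}=\sup_B\frac1{\mu(B)}\int_B|f-f_B|\,d\mu,\qquad \|f\|_{BLO}=\sup_B\Big(f_B-\operatorname*{ess\,inf}_{B}f\Big),\qquad Mf(x)=\sup_{B\ni x}\frac1{\mu(B)}\int_B|f|\,d\mu,$$ the suprema being over all open balls $B$ (containing $x$, in the case of $Mf$), and let $BMO(X)$ and $BLO(X)$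 be the sets of $f\in L^1_{\mathrm{loc}}(X)$ with $\|f\|_{BMO}<\infty$ and $\|f\|_{BLO}<\infty$, respectively. If $f\in BMO(X)$ and $Mf$ is not identically $+\infty$, then $Mf$ is finite almost everywhere, $Mf\in BLO(X)$, and $$\|Mf\|_{BLO}\le C\,\|f\|_{BMO}.$$ -/

import Mathlib

open MeasureTheory Metric
open scoped ENNReal

noncomputable section

/-- The measure `μ` is doubling with constant `Cd`:
`0 < μ(2B) ≤ Cd μ(B) < ∞` for all open balls `B = B(x, r)`, `r > 0`. -/
def IsDoublingWith {X : Type*} [MetricSpace X] [MeasurableSpace X]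
    (μ : Measure X) (Cd : ℝ) : Prop :=
  1 < Cd ∧ ∀ (x : X) (r : ℝ), 0 < r →
    0 < μ (ball x (2 * r)) ∧
    μ (ball x (2 * r)) ≤ ENNReal.ofReal Cd * μ (ball x r) ∧
    ENNReal.ofReal Cd * μ (ball x r) < ∞

/-- The `α`-annular decay property, `0 ≤ α ≤ 1`. -/
def AnnularDecayWith {X : Type*} [MetricSpace X] [MeasurableSpace X]
    (μ : Measure X) (α : ℝ) : Prop :=
  0 ≤ α ∧ α ≤ 1 ∧ ∃ K : ℝ, 1 ≤ K ∧
    ∀ (x : X) (r δ : ℝ), 0 < r → 0 < δ → δ < 1 →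
      μ (ball x r \ ball x ((1 - δ) * r)) ≤ ENNReal.ofReal (K * δ ^ α) * μ (ball x r)

/-- An annular decay property: the `α`-annular decay property for some `0 ≤ α ≤ 1`. -/
def AnnularDecay {X : Type*} [MetricSpace X] [MeasurableSpace X] (μ : Measure X) : Prop :=
  ∃ α : ℝ, AnnularDecayWith μ α

/-- `f ∈ L¹_loc(X)`: `f` is integrable on every compact subset. -/
def MemL1loc {X : Type*} [MetricSpace X] [MeasurableSpace X] (μ : Measure X) (f : X → ℝ) : Prop :=
  ∀ K : Set X, IsCompact K → IntegrableOn f K μ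

/-- The uncentred Hardy–Littlewood maximal function, with values in `[0, ∞]`: the supremum of
the averages of `|f|` over all open balls containing the point `x`. -/
def maximalFn {X : Type*} [MetricSpace X] [MeasurableSpace X]
    (μ : Measure X) (f : X → ℝ) (x : X) : ℝ≥0∞ :=
  ⨆ (z : X) (r : ℝ) (_ : 0 < r) (_ : x ∈ ball z r), ⨍⁻ y in ball z r, ‖f y‖ₑ ∂μ

/-- `‖f‖_BMO`, the supremum over all balls `B` of the average over `B` of `|f - f_B|`. -/
def bmoNorm {X : Type*} [MetricSpace X] [MeasurableSpace X]
    (μ : Measure X) (f : X → ℝ) : EReal :=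
  ⨆ (z : X) (r : ℝ) (_ : 0 < r),
    ((⨍ x in ball z r, |f x - ⨍ y in ball z r, f y ∂μ| ∂μ : ℝ) : EReal)

/-- `f ∈ BMO(X)`. -/
def MemBMO {X : Type*} [MetricSpace X] [MeasurableSpace X] (μ : Measure X) (f : X → ℝ) : Prop :=
  MemL1loc μ f ∧ bmoNorm μ f < ⊤

/-- `‖f‖_BLO`, the supremum over all balls `B` of `f_B - ess inf_B f`. The essential infimum is
taken in the extended reals, so it is `-∞` if `f` is not essentially bounded below on `B`. -/
def bloNorm {X : Type*} [MetricSpace X] [MeasurableSpace X]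
    (μ : Measure X) (f : X → ℝ) : EReal :=
  ⨆ (z : X) (r : ℝ) (_ : 0 < r),
    ((⨍ x in ball z r, f x ∂μ : ℝ) : EReal) -
      essInf (fun x => (f x : EReal)) (μ.restrict (ball z r))

/-- `f ∈ BLO(X)`. -/
def MemBLO {X : Type*} [MetricSpace X] [MeasurableSpace X] (μ : Measure X) (f : X → ℝ) : Prop :=
  MemL1loc μ f ∧ bloNorm μ f < ⊤

end

/-! Fix a ball `B` of radius `r` and `x, y ∈ B`. A ball through `x` of radius at most `r` has mean
of `|f|` at most its mean of `|f - f_B|` plus `|f_B| ≤ Mf(y)`. For a larger ball, the fourfold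
enlargement contains `y`, so doubling costs only a multiple of the oscillation bound `A`. This is
`OscLE.maximalFn_le_add`; averaging in `x` reduces the theorem to bounding the mean over `B` of the
local maximal function of `f - f_B`.

That bound, `OscLE.setLIntegral_oscMaximal_le`, replaces the John–Nirenberg inequality by
absorption. Let `G` be the supremum over all balls of the means of the truncated local maximal
functions. Stopping balls, chosen by Vitali covering, have fivefold enlargements of total measure at
most `μ(B)/2`. Off these the function is at most a constant `J`, and on each it exceeds `J` by at
most contributions of the same kind. Hence `G ≤ J + G/2`, so `G ≤ 2J` independently of the
truncation. -/

/-! ### Averages over sets of finite positive measure -/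

section Averages

variable {X : Type*} [MeasurableSpace X] {μ : Measure X} {s t : Set X}

/-- The average over a subset of comparable measure is controlled by the average over the set. -/
lemma setLAverage_le_mul_setLAverage {K : ℝ≥0∞} (g : X → ℝ≥0∞) (hst : s ⊆ t)
    (hK : μ t ≤ K * μ s) (ht : μ t ≠ ∞) :
    ⨍⁻ x in s, g x ∂μ ≤ K * ⨍⁻ x in t, g x ∂μ := by
  rw [setLAverage_eq]
  refine ENNReal.div_le_of_le_mul ?_
  calc ∫⁻ x in s, g x ∂μ ≤ ∫⁻ x in t, g x ∂μ := lintegral_mono_set hst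
    _ = μ t * ⨍⁻ x in t, g x ∂μ := (measure_mul_setLAverage g ht).symm
    _ ≤ (K * μ s) * ⨍⁻ x in t, g x ∂μ := by gcongr
    _ = K * (⨍⁻ x in t, g x ∂μ) * μ s := by ring

lemma setLAverage_add_const_le (g : X → ℝ≥0∞) (hs₀ : μ s ≠ 0) (hs : μ s ≠ ∞) (c : ℝ≥0∞) :
    ⨍⁻ x in s, (g x + c) ∂μ = (⨍⁻ x in s, g x ∂μ) + c := by
  rw [setLAverage_eq, setLAverage_eq, lintegral_add_right _ measurable_const, setLIntegral_const,
    ENNReal.add_div, ENNReal.mul_div_cancel_right hs₀ hs]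

lemma setLAverage_enorm_sub_le (f : X → ℝ) (hs₀ : μ s ≠ 0) (hs : μ s ≠ ∞) (c c' : ℝ) :
    ⨍⁻ x in s, ‖f x - c‖ₑ ∂μ ≤ (⨍⁻ x in s, ‖f x - c'‖ₑ ∂μ) + ‖c' - c‖ₑ := by
  rw [← setLAverage_add_const_le _ hs₀ hs]
  refine lintegral_mono fun x => ?_
  calc ‖f x - c‖ₑ = ‖(f x - c') + (c' - c)‖ₑ := by ring_nf
    _ ≤ _ := enorm_add_le _ _

lemma enorm_setAverage_sub_le {f : X → ℝ} (hf : IntegrableOn f s μ) (hs₀ : μ s ≠ 0)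
    (hs : μ s ≠ ∞) (c : ℝ) :
    ‖(⨍ x in s, f x ∂μ) - c‖ₑ ≤ ⨍⁻ x in s, ‖f x - c‖ₑ ∂μ := by
  have h : (⨍ x in s, f x ∂μ) - c = ⨍ x in s, (f x - c) ∂μ := by
    have hc : ⨍ _ in s, c ∂μ = c := setAverage_const hs₀ hs c
    conv_lhs => rw [← hc]
    have : IsFiniteMeasure (μ.restrict s) := ⟨by simpa using hs.lt_top⟩
    exact (integral_sub (Integrable.to_average hf)
      (Integrable.to_average (integrable_const c))).symm
  rw [h]
  exact enorm_integral_le_lintegral_enorm _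

end Averages

/-! ### Consequences of doubling -/

section Doubling

variable {X : Type*} [MetricSpace X] [MeasurableSpace X] {μ : Measure X} {Cd : ℝ}

namespace IsDoublingWith

lemma measure_ball_ne_zero (h : IsDoublingWith μ Cd) (x : X) {r : ℝ} (hr : 0 < r) :
    μ (ball x r) ≠ 0 := by
  have := (h.2 x (r / 2) (by positivity)).1
  rw [mul_div_cancel₀ r two_ne_zero] at this
  exact this.ne'

lemma ofReal_ne_zero (h : IsDoublingWith μ Cd) : ENNReal.ofReal Cd ≠ 0 := by
  have := h.1
  simp only [ne_eq, ENNReal.ofReal_eq_zero, not_le]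
  linarith

lemma measure_ball_ne_top (h : IsDoublingWith μ Cd) (x : X) (r : ℝ) : μ (ball x r) ≠ ∞ := by
  rcases le_or_gt r 0 with hr | hr
  · simp [ball_eq_empty.2 hr]
  · intro htop
    have := (h.2 x r hr).2.2
    rw [htop, ENNReal.mul_top h.ofReal_ne_zero] at this
    exact this.ne rfl

lemma measure_ball_two_pow_mul_le (h : IsDoublingWith μ Cd) (w : X) {s : ℝ} (hs : 0 < s) (k : ℕ) :
    μ (ball w (2 ^ k * s)) ≤ ENNReal.ofReal Cd ^ k * μ (ball w s) := by
  induction k with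
  | zero => simp
  | succ k ih =>
    calc μ (ball w (2 ^ (k + 1) * s)) = μ (ball w (2 * (2 ^ k * s))) := by ring_nf
      _ ≤ ENNReal.ofReal Cd * μ (ball w (2 ^ k * s)) := (h.2 w _ (by positivity)).2.1
      _ ≤ ENNReal.ofReal Cd * (ENNReal.ofReal Cd ^ k * μ (ball w s)) := by gcongr
      _ = _ := by ring

lemma measure_ball_le (h : IsDoublingWith μ Cd) {z w : X} {r s : ℝ} (hs : 0 < s) (k : ℕ)
    (hk : r + dist z w ≤ 2 ^ k * s) :
    μ (ball z r) ≤ ENNReal.ofReal Cd ^ k * μ (ball w s) :=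
  (measure_mono (ball_subset_ball' hk)).trans (h.measure_ball_two_pow_mul_le w hs k)

lemma setLAverage_ball_le (h : IsDoublingWith μ Cd) (g : X → ℝ≥0∞) {z w : X} {r s : ℝ}
    (hs : 0 < s) (k : ℕ) (hk : r + dist z w ≤ 2 ^ k * s) (hsub : ball w s ⊆ ball z r) :
    ⨍⁻ x in ball w s, g x ∂μ ≤ ENNReal.ofReal Cd ^ k * ⨍⁻ x in ball z r, g x ∂μ :=
  setLAverage_le_mul_setLAverage g hsub (h.measure_ball_le hs k hk) (h.measure_ball_ne_top z r)

variable [OpensMeasurableSpace X]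

/-- Disjoint balls of radius `ε / 2` centred in the ball each carry a fixed share of the finite
measure of `ball x (r + ε)`, so there are finitely many. -/
lemma totallyBounded_ball (h : IsDoublingWith μ Cd) (x : X) (r : ℝ) :
    TotallyBounded (ball x r) := by
  rw [Metric.totallyBounded_iff]
  intro ε hε
  -- With constant size function, the covering property says only that every ball meets a selected
  -- one.
  obtain ⟨u, hu, hdisj, hcov⟩ := Vitali.exists_disjoint_subfamily_covering_enlargement
    (fun y : X => ball y (ε / 2)) (ball x r) (fun _ => (1 : ℝ)) 2 one_lt_two (by simp) 1 (by simp)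
    (fun y _ => ⟨y, mem_ball_self (by positivity)⟩)
  refine ⟨u, ?_, fun y hy => ?_⟩
  · obtain ⟨k, hk⟩ := pow_unbounded_of_one_lt ((r + ε + r) / (ε / 2)) one_lt_two
    rw [div_lt_iff₀ (by positivity)] at hk
    have hD : ENNReal.ofReal Cd ^ k ≠ 0 := pow_ne_zero _ h.ofReal_ne_zero
    have hDt : ENNReal.ofReal Cd ^ k ≠ ∞ := ENNReal.pow_ne_top ENNReal.ofReal_ne_top
    by_cases hr : 0 < r
    swap
    · rw [ball_eq_empty.2 (not_lt.1 hr)] at hu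
      exact (Set.finite_empty).subset hu
    have hfin := Measure.finite_const_le_meas_of_disjoint_iUnion (ι := u) μ
      (ε := (ENNReal.ofReal Cd ^ k)⁻¹ * μ (ball x (r + ε)))
      (ENNReal.mul_pos (ENNReal.inv_ne_zero.2 hDt) (h.measure_ball_ne_zero x (by positivity)))
      (As := fun y : u => ball (y : X) (ε / 2)) (fun _ => measurableSet_ball)
      (fun a b hab => hdisj a.2 b.2 (fun e => hab (Subtype.ext e)))
      (ne_top_of_le_ne_top (h.measure_ball_ne_top x (r + ε)) (measure_mono
        (Set.iUnion_subset fun y => ball_subset_ball' (by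
          have := mem_ball.1 (hu y.2); linarith))))
    have huniv : {i : u | (ENNReal.ofReal Cd ^ k)⁻¹ * μ (ball x (r + ε)) ≤
        μ (ball (i : X) (ε / 2))} = Set.univ := by
      refine Set.eq_univ_of_forall fun y => ?_
      have hy := mem_ball'.1 (hu y.2)
      exact ENNReal.inv_mul_le_iff hD hDt |>.2 (h.measure_ball_le (by positivity) k (by linarith))
    rw [huniv] at hfin
    exact Set.finite_coe_iff.1 (Set.finite_univ_iff.1 hfin)
  · obtain ⟨b, hb, ⟨w, hw1, hw2⟩, -⟩ := hcov y hy
    refine Set.mem_iUnion₂.2 ⟨b, hb, ?_⟩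
    have := dist_triangle y w b
    rw [mem_ball] at *
    rw [dist_comm] at hw1
    linarith

/-- Properness turns integrability on compact sets into integrability on balls, and yields second
countability. -/
lemma properSpace [CompleteSpace X] (h : IsDoublingWith μ Cd) : ProperSpace X :=
  ⟨fun x r => isCompact_iff_totallyBounded_isComplete.2
    ⟨(h.totallyBounded_ball x (r + 1)).subset (closedBall_subset_ball (by linarith)),
      isClosed_closedBall.isComplete⟩⟩

end IsDoublingWith

end Doubling

/-! ### Maximal functions and stopping balls -/

lemma lowerSemicontinuous_iSup_mem_ball {X : Type*} [MetricSpace X] (z : X) (r : ℝ) (c : ℝ≥0∞) :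
    LowerSemicontinuous fun x => ⨆ _ : x ∈ ball z r, c := by
  have : (fun x => ⨆ _ : x ∈ ball z r, c) = (ball z r).indicator fun _ => c := by
    ext x
    by_cases hx : x ∈ ball z r <;> simp [hx]
  rw [this]
  exact isOpen_ball.lowerSemicontinuous_indicator zero_le

section Maximal

variable {X : Type*} [MetricSpace X] [MeasurableSpace X] {μ : Measure X}

/-- The maximal function of `g` over balls of radius at most `R`. -/
noncomputable def maximalUpTo (μ : Measure X) (g : X → ℝ≥0∞) (R : ℝ) (x : X) : ℝ≥0∞ :=
  ⨆ (z : X) (r : ℝ) (_ : 0 < r ∧ r ≤ R) (_ : x ∈ ball z r), ⨍⁻ y in ball z r, g y ∂μ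

lemma le_maximalUpTo (g : X → ℝ≥0∞) {R r : ℝ} {x z : X} (hr : 0 < r) (hR : r ≤ R)
    (hx : x ∈ ball z r) : ⨍⁻ y in ball z r, g y ∂μ ≤ maximalUpTo μ g R x :=
  le_iSup₂_of_le z r (le_iSup₂_of_le ⟨hr, hR⟩ hx le_rfl)

lemma maximalUpTo_le {g : X → ℝ≥0∞} {R : ℝ} {x : X} {c : ℝ≥0∞}
    (h : ∀ z r, 0 < r → r ≤ R → x ∈ ball z r → ⨍⁻ y in ball z r, g y ∂μ ≤ c) :
    maximalUpTo μ g R x ≤ c :=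
  iSup₂_le fun z r => iSup₂_le fun hr hx => h z r hr.1 hr.2 hx

lemma setLAverage_le_maximalFn (f : X → ℝ) {r : ℝ} {x z : X} (hr : 0 < r)
    (hx : x ∈ ball z r) : ⨍⁻ y in ball z r, ‖f y‖ₑ ∂μ ≤ maximalFn μ f x :=
  le_iSup₂_of_le z r (le_iSup₂_of_le hr hx le_rfl)

lemma maximalFn_le {f : X → ℝ} {x : X} {c : ℝ≥0∞}
    (h : ∀ z r, 0 < r → x ∈ ball z r → ⨍⁻ y in ball z r, ‖f y‖ₑ ∂μ ≤ c) :
    maximalFn μ f x ≤ c :=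
  iSup₂_le fun z r => iSup₂_le fun hr hx => h z r hr hx

/-- Among the balls of radius at most `r` meeting `ball z r` on which the average of `g` exceeds
`Λ`, one can select disjoint ones, whose fivefold enlargements either are large or have average
at most `Λ`, such that the enlargements cover all the balls. -/
lemma exists_stopping_family [SecondCountableTopology X] (g : X → ℝ≥0∞) (z : X) (r : ℝ)
    (Λ : ℝ≥0∞) :
    ∃ u : Set (X × ℝ), u.Countable ∧ u.PairwiseDisjoint (fun p => ball p.1 p.2) ∧
      (∀ p ∈ u, 0 < p.2 ∧ p.2 ≤ r ∧ (ball p.1 p.2 ∩ ball z r).Nonempty ∧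
        Λ < ⨍⁻ y in ball p.1 p.2, g y ∂μ ∧
        (5 * p.2 ≤ r → ⨍⁻ y in ball p.1 (5 * p.2), g y ∂μ ≤ Λ)) ∧
      ∀ w s, 0 < s → s ≤ r → (ball w s ∩ ball z r).Nonempty →
        Λ < ⨍⁻ y in ball w s, g y ∂μ → ∃ p ∈ u, ball w s ⊆ ball p.1 (5 * p.2) ∧ s ≤ 5 * p.2 := by
  let t : Set (X × ℝ) := {p | 0 < p.2 ∧ p.2 ≤ r ∧ (ball p.1 p.2 ∩ ball z r).Nonempty ∧
        Λ < ⨍⁻ y in ball p.1 p.2, g y ∂μ ∧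
        (5 * p.2 ≤ r → ⨍⁻ y in ball p.1 (5 * p.2), g y ∂μ ≤ Λ)}
  obtain ⟨u, hu, hdisj, hcov⟩ := Vitali.exists_disjoint_subfamily_covering_enlargement
    (fun p : X × ℝ => ball p.1 p.2) t (fun p => p.2) 2 one_lt_two (fun p hp => hp.1.le) r
    (fun p hp => hp.2.1) (fun p hp => ⟨p.1, mem_ball_self hp.1⟩)
  refine ⟨u, hdisj.countable_of_isOpen (fun _ _ => isOpen_ball)
    (fun p hp => ⟨p.1, mem_ball_self (hu hp).1⟩), hdisj, fun p hp => hu hp, ?_⟩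
  intro w s hs hsr hne hΛ
  -- Enlarge by factors of 5 until the next enlargement has radius above `r` or average at most `Λ`.
  obtain ⟨k, ⟨hk, hkr⟩, hk'⟩ : ∃ k : ℕ, (Λ < ⨍⁻ y in ball w (5 ^ k * s), g y ∂μ ∧ 5 ^ k * s ≤ r) ∧
      ¬ (Λ < ⨍⁻ y in ball w (5 ^ (k + 1) * s), g y ∂μ ∧ 5 ^ (k + 1) * s ≤ r) := by
    by_contra! hcon
    have hall : ∀ k : ℕ, Λ < ⨍⁻ y in ball w (5 ^ k * s), g y ∂μ ∧ 5 ^ k * s ≤ r := by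
      intro k
      induction k with
      | zero => simpa using ⟨hΛ, hsr⟩
      | succ k ih => exact hcon k ih
    obtain ⟨k, hk⟩ := pow_unbounded_of_one_lt (r / s) (by norm_num : (1 : ℝ) < 5)
    rw [div_lt_iff₀ hs] at hk
    exact absurd (hall k).2 (not_le.2 hk)
  have hle : s ≤ 5 ^ k * s := le_mul_of_one_le_left hs.le (one_le_pow₀ (by norm_num))
  have hmul : 5 * (5 ^ k * s) = 5 ^ (k + 1) * s := by ring
  have hmem : (w, 5 ^ k * s) ∈ t := by
    refine ⟨by positivity, hkr, hne.mono (Set.inter_subset_inter_left _ (ball_subset_ball hle)),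
      hk, fun h5 => ?_⟩
    dsimp only at h5 ⊢
    rw [hmul] at h5 ⊢
    exact not_lt.1 fun hlt => hk' ⟨hlt, h5⟩
  obtain ⟨p, hp, ⟨v, hv1, hv2⟩, hsp⟩ := hcov _ hmem
  dsimp only at hv1 hsp
  have hp0 := (hu hp).1
  -- The enlarged radius is at most `2 * p.2` and the two balls meet, whence the factor `2 + 2 + 1 =
  -- 5`.
  refine ⟨p, hp, ball_subset_ball' ?_, by linarith⟩
  have := dist_triangle_left w p.1 v
  rw [mem_ball] at hv1 hv2
  linarith

variable [OpensMeasurableSpace X]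

lemma measurable_maximalUpTo (g : X → ℝ≥0∞) (R : ℝ) : Measurable (maximalUpTo μ g R) := by
  refine LowerSemicontinuous.measurable ?_
  exact lowerSemicontinuous_iSup fun z => lowerSemicontinuous_iSup fun r =>
    lowerSemicontinuous_iSup fun _ => lowerSemicontinuous_iSup_mem_ball z r _

lemma measurable_maximalFn (f : X → ℝ) : Measurable (maximalFn μ f) := by
  refine LowerSemicontinuous.measurable ?_
  exact lowerSemicontinuous_iSup fun z => lowerSemicontinuous_iSup fun r =>
    lowerSemicontinuous_iSup fun _ => lowerSemicontinuous_iSup_mem_ball z r _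

end Maximal

/-! ### Mean bound for the local maximal function of the oscillation -/

section Oscillation

variable {X : Type*} [MetricSpace X] [MeasurableSpace X] {μ : Measure X}

/-- The average of `f` over the ball `B(z, r)`. -/
noncomputable def ballAvg (μ : Measure X) (f : X → ℝ) (z : X) (r : ℝ) : ℝ :=
  ⨍ y in ball z r, f y ∂μ

/-- The mean oscillation of `f` over every ball is at most `A`. -/
def OscLE (μ : Measure X) (f : X → ℝ) (A : ℝ≥0∞) : Prop :=
  ∀ z r, 0 < r → IntegrableOn f (ball z r) μ ∧
    ⨍⁻ x in ball z r, ‖f x - ballAvg μ f z r‖ₑ ∂μ ≤ A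

/-- The maximal function of the oscillation of `f` about its average over `B(z, r)`, over balls
of radius at most `r`. -/
noncomputable def oscMaximal (μ : Measure X) (f : X → ℝ) (z : X) (r : ℝ) : X → ℝ≥0∞ :=
  maximalUpTo μ (fun y => ‖f y - ballAvg μ f z r‖ₑ) r

variable {Cd : ℝ} {f : X → ℝ} {A : ℝ≥0∞}

lemma OscLE.enorm_ballAvg_sub_le (hf : OscLE μ f A) (h : IsDoublingWith μ Cd) {z w : X} {r s : ℝ}
    (hs : 0 < s) (k : ℕ) (hk : r + dist z w ≤ 2 ^ k * s) (hsub : s + dist w z ≤ r) :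
    ‖ballAvg μ f w s - ballAvg μ f z r‖ₑ ≤ ENNReal.ofReal Cd ^ k * A := by
  have hr : 0 < r := by linarith [dist_nonneg (x := w) (y := z)]
  calc _ ≤ ⨍⁻ x in ball w s, ‖f x - ballAvg μ f z r‖ₑ ∂μ :=
        enorm_setAverage_sub_le (hf w s hs).1 (h.measure_ball_ne_zero w hs)
          (h.measure_ball_ne_top w s) _
    _ ≤ ENNReal.ofReal Cd ^ k * ⨍⁻ x in ball z r, ‖f x - ballAvg μ f z r‖ₑ ∂μ :=
        h.setLAverage_ball_le _ hs k hk (ball_subset_ball' hsub)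
    _ ≤ _ := by gcongr; exact (hf z r hr).2

/-- Balls of radius at most `r` meeting `ball z r` lie in `ball z (4 * r)`, so this controls the
total mass on the stopping balls. -/
lemma OscLE.setLIntegral_four_mul_le (hf : OscLE μ f A) (h : IsDoublingWith μ Cd) (z : X) {r : ℝ}
    (hr : 0 < r) :
    ∫⁻ x in ball z (4 * r), ‖f x - ballAvg μ f z r‖ₑ ∂μ ≤
      (1 + ENNReal.ofReal Cd ^ 2) * ENNReal.ofReal Cd ^ 2 * A * μ (ball z r) := by
  have h4 : 0 < 4 * r := by positivity
  have hz := h.measure_ball_ne_zero z h4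
  have ht := h.measure_ball_ne_top z (4 * r)
  have hm := hf.enorm_ballAvg_sub_le h (z := z) (w := z) (r := 4 * r) hr 2
    (by rw [dist_self]; linarith) (by rw [dist_self]; linarith)
  rw [← measure_mul_setLAverage _ ht]
  calc _ ≤ (ENNReal.ofReal Cd ^ 2 * μ (ball z r)) * (A + ENNReal.ofReal Cd ^ 2 * A) := by
        gcongr
        · exact h.measure_ball_le hr 2 (by rw [dist_self]; linarith)
        · refine (setLAverage_enorm_sub_le f hz ht _ (ballAvg μ f z (4 * r))).trans ?_
          gcongr
          · exact (hf z _ h4).2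
          · rwa [enorm_sub_rev]
    _ = _ := by ring

/-- Handles enlargements too big for the stopping condition: both balls lie in `ball z (8 * r)` and
are comparable to it. -/
lemma OscLE.enorm_ballAvg_five_mul_sub_le (hf : OscLE μ f A) (h : IsDoublingWith μ Cd)
    {z w : X} {r s : ℝ} (hr : 0 < r) (hs : 0 < s) (hsr : s ≤ r) (hrs : r < 5 * s)
    (hne : (ball w s ∩ ball z r).Nonempty) :
    ‖ballAvg μ f w (5 * s) - ballAvg μ f z r‖ₑ ≤
      (ENNReal.ofReal Cd ^ 3 + ENNReal.ofReal Cd ^ 4) * A := by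
  obtain ⟨v, hv1, hv2⟩ := hne
  have hd := dist_triangle_left w z v
  rw [mem_ball] at hv1 hv2
  have h1 := hf.enorm_ballAvg_sub_le h (z := z) (w := z) (r := 8 * r) hr 3
    (by rw [dist_self]; linarith) (by rw [dist_self]; linarith)
  have h2 := hf.enorm_ballAvg_sub_le h (z := z) (w := w) (r := 8 * r) (s := 5 * s)
    (by positivity) 4 (by rw [dist_comm]; linarith) (by linarith)
  calc _ = ‖(ballAvg μ f w (5 * s) - ballAvg μ f z (8 * r)) +
        (ballAvg μ f z (8 * r) - ballAvg μ f z r)‖ₑ := by ring_nf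
    _ ≤ _ := enorm_add_le _ _
    _ ≤ ENNReal.ofReal Cd ^ 4 * A + ENNReal.ofReal Cd ^ 3 * A := by
        gcongr
        rwa [enorm_sub_rev]
    _ = _ := by ring

/-- The height at which the averages are stopped. -/
noncomputable def stopHeight (Cd : ℝ) (A : ℝ≥0∞) : ℝ≥0∞ :=
  2 * (ENNReal.ofReal Cd ^ 5 * (1 + ENNReal.ofReal Cd ^ 2) * A)

/-- A bound for the growth of averages from a ball to the enlarged stopping balls. -/
noncomputable def stopJump (Cd : ℝ) (A : ℝ≥0∞) : ℝ≥0∞ :=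
  stopHeight Cd A + (ENNReal.ofReal Cd ^ 3 + ENNReal.ofReal Cd ^ 4) * A

variable [OpensMeasurableSpace X]

lemma measurable_oscMaximal (z : X) (r : ℝ) : Measurable (oscMaximal μ f z r) :=
  measurable_maximalUpTo _ _

/-- The weak type estimate for the stopping balls. -/
lemma OscLE.two_mul_tsum_measure_le (hf : OscLE μ f A) (h : IsDoublingWith μ Cd) (hA₀ : A ≠ 0)
    (hA : A ≠ ∞) {z : X} {r : ℝ} (hr : 0 < r) {u : Set (X × ℝ)} (hu : u.Countable)
    (hdisj : u.PairwiseDisjoint (fun p => ball p.1 p.2))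
    (hball : ∀ p ∈ u, 0 < p.2 ∧ p.2 ≤ r ∧ (ball p.1 p.2 ∩ ball z r).Nonempty ∧
      stopHeight Cd A < ⨍⁻ y in ball p.1 p.2, ‖f y - ballAvg μ f z r‖ₑ ∂μ) :
    2 * ∑' p : u, μ (ball (p : X × ℝ).1 (5 * (p : X × ℝ).2)) ≤ μ (ball z r) := by
  have := hu.to_subtype
  set D := ENNReal.ofReal Cd with hD
  have hD₀ : D ≠ 0 := h.ofReal_ne_zero
  have hDt : D ≠ ∞ := ENNReal.ofReal_ne_top
  have hκ₀ : D ^ 5 * (1 + D ^ 2) * A ≠ 0 :=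
    mul_ne_zero (mul_ne_zero (pow_ne_zero _ hD₀) (by simp)) hA₀
  have hκt : D ^ 5 * (1 + D ^ 2) * A ≠ ∞ := by finiteness
  have hsum : ∑' p : u, stopHeight Cd A * μ (ball (p : X × ℝ).1 (p : X × ℝ).2) ≤
      (1 + D ^ 2) * D ^ 2 * A * μ (ball z r) := by
    calc _ ≤ ∑' p : u, ∫⁻ x in ball (p : X × ℝ).1 (p : X × ℝ).2, ‖f x - ballAvg μ f z r‖ₑ ∂μ := by
          refine ENNReal.tsum_le_tsum fun p => ?_
          rw [← measure_mul_setLAverage _ (h.measure_ball_ne_top _ _), mul_comm]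
          gcongr
          exact (hball p p.2).2.2.2.le
      _ = ∫⁻ x in ⋃ p : u, ball (p : X × ℝ).1 (p : X × ℝ).2, ‖f x - ballAvg μ f z r‖ₑ ∂μ :=
          (lintegral_iUnion (s := fun p : u => ball (p : X × ℝ).1 (p : X × ℝ).2)
            (fun _ => measurableSet_ball)
            (fun a b hab => hdisj a.2 b.2 (fun e => hab (Subtype.ext e))) _).symm
      _ ≤ ∫⁻ x in ball z (4 * r), ‖f x - ballAvg μ f z r‖ₑ ∂μ := by
          refine lintegral_mono_set (Set.iUnion_subset fun p => ball_subset_ball' ?_)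
          obtain ⟨hp0, hpr, ⟨v, hv1, hv2⟩, -⟩ := hball p p.2
          have := dist_triangle_left (p : X × ℝ).1 z v
          rw [mem_ball] at hv1 hv2
          linarith
      _ ≤ _ := hf.setLIntegral_four_mul_le h z hr
  rw [ENNReal.tsum_mul_left] at hsum
  have h5 : ∑' p : u, μ (ball (p : X × ℝ).1 (5 * (p : X × ℝ).2)) ≤
      D ^ 3 * ∑' p : u, μ (ball (p : X × ℝ).1 (p : X × ℝ).2) := by
    rw [← ENNReal.tsum_mul_left]
    refine ENNReal.tsum_le_tsum fun p => ?_
    have hp := (hball p p.2).1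
    exact h.measure_ball_le hp 3 (by rw [dist_self]; linarith)
  -- The cancelled factor is half of `stopHeight`: `D ^ 3` pays for the fivefold enlargement, the
  -- rest for the integral over `ball z (4 * r)`. Cancelling needs `A` nonzero and finite.
  refine (ENNReal.mul_le_mul_iff_right hκ₀ hκt).1 ?_
  calc _ ≤ (D ^ 5 * (1 + D ^ 2) * A) *
        (2 * (D ^ 3 * ∑' p : u, μ (ball (p : X × ℝ).1 (p : X × ℝ).2))) := by gcongr
    _ = D ^ 3 * (stopHeight Cd A * ∑' p : u, μ (ball (p : X × ℝ).1 (p : X × ℝ).2)) := by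
        rw [stopHeight]; ring
    _ ≤ D ^ 3 * ((1 + D ^ 2) * D ^ 2 * A * μ (ball z r)) := by gcongr
    _ = _ := by ring

/-- One step of the iteration: the truncated maximal function is bounded by a constant outside the
enlarged stopping balls, and by a constant plus the corresponding truncated maximal function on
each of them. -/
lemma OscLE.setLIntegral_min_oscMaximal_le [SecondCountableTopology X] (hf : OscLE μ f A)
    (h : IsDoublingWith μ Cd) (hA₀ : A ≠ 0) (hA : A ≠ ∞) (N G : ℝ≥0∞)
    (hG : ∀ z r, 0 < r → ∫⁻ x in ball z r, min (oscMaximal μ f z r x) N ∂μ ≤ G * μ (ball z r))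
    (z : X) {r : ℝ} (hr : 0 < r) :
    ∫⁻ x in ball z r, min (oscMaximal μ f z r x) N ∂μ ≤
      (stopJump Cd A + G / 2) * μ (ball z r) := by
  obtain ⟨u, huc, hdisj, hu, hcov⟩ := exists_stopping_family (μ := μ)
    (fun y => ‖f y - ballAvg μ f z r‖ₑ) z r (stopHeight Cd A)
  have := huc.to_subtype
  let φ : u → X → ℝ≥0∞ := fun p => (ball (p : X × ℝ).1 (5 * (p : X × ℝ).2)).indicator
    fun x => min (oscMaximal μ f (p : X × ℝ).1 (5 * (p : X × ℝ).2) x) N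
  have hφ : ∀ p, Measurable (φ p) := fun p =>
    ((measurable_oscMaximal _ _).min measurable_const).indicator measurableSet_ball
  have hjump : ∀ p ∈ u, ‖ballAvg μ f p.1 (5 * p.2) - ballAvg μ f z r‖ₑ ≤ stopJump Cd A := by
    intro p hp
    obtain ⟨hp0, hpr, hne, -, hsmall⟩ := hu p hp
    have hp5 : 0 < 5 * p.2 := by positivity
    rcases le_or_gt (5 * p.2) r with h5 | h5
    · exact (enorm_setAverage_sub_le (hf _ _ hp5).1 (h.measure_ball_ne_zero _ hp5)
        (h.measure_ball_ne_top _ _) _).trans ((hsmall h5).trans le_self_add)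
    · exact (hf.enorm_ballAvg_five_mul_sub_le h hr hp0 hpr h5 hne).trans le_add_self
  have hpt : ∀ x ∈ ball z r,
      min (oscMaximal μ f z r x) N ≤ stopJump Cd A + ∑' p, φ p x := by
    intro x hx
    refine min_le_iff.2 ?_
    -- If `N` exceeds the right side, the truncation on the enlarged ball containing `x` is
    -- inactive.
    by_cases hN : N ≤ stopJump Cd A + ∑' p, φ p x
    · exact Or.inr hN
    left
    refine maximalUpTo_le fun w s hs hsr hxw => ?_
    rcases le_or_gt (⨍⁻ y in ball w s, ‖f y - ballAvg μ f z r‖ₑ ∂μ) (stopHeight Cd A) with hle | hlt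
    · exact hle.trans (le_self_add.trans le_self_add)
    obtain ⟨p, hp, hsub, hsp⟩ := hcov w s hs hsr ⟨x, hxw, hx⟩ hlt
    have hφx : φ ⟨p, hp⟩ x = min (oscMaximal μ f p.1 (5 * p.2) x) N :=
      Set.indicator_of_mem (hsub hxw) _
    have hφle : φ ⟨p, hp⟩ x ≤ ∑' p, φ p x := ENNReal.le_tsum _
    have hmin : oscMaximal μ f p.1 (5 * p.2) x ≤ ∑' p, φ p x := by
      rw [hφx] at hφle
      exact (min_le_iff.1 hφle).resolve_right fun hle => hN (hle.trans le_add_self)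
    calc _ ≤ (⨍⁻ y in ball w s, ‖f y - ballAvg μ f p.1 (5 * p.2)‖ₑ ∂μ) +
          ‖ballAvg μ f p.1 (5 * p.2) - ballAvg μ f z r‖ₑ :=
          setLAverage_enorm_sub_le f (h.measure_ball_ne_zero w hs) (h.measure_ball_ne_top w s) _ _
      _ ≤ oscMaximal μ f p.1 (5 * p.2) x + stopJump Cd A :=
          add_le_add (le_maximalUpTo _ hs hsp hxw) (hjump p hp)
      _ ≤ _ := by rw [add_comm]; gcongr
  have hsum := hf.two_mul_tsum_measure_le h hA₀ hA hr huc hdisj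
    (fun p hp => ⟨(hu p hp).1, (hu p hp).2.1, (hu p hp).2.2.1, (hu p hp).2.2.2.1⟩)
  calc _ ≤ ∫⁻ x in ball z r, (stopJump Cd A + ∑' p, φ p x) ∂μ :=
        setLIntegral_mono' measurableSet_ball hpt
    _ = stopJump Cd A * μ (ball z r) + ∑' p, ∫⁻ x in ball z r, φ p x ∂μ := by
        rw [lintegral_add_left measurable_const, setLIntegral_const,
          lintegral_tsum fun p => (hφ p).aemeasurable]
    _ ≤ stopJump Cd A * μ (ball z r) +
          ∑' p : u, G * μ (ball (p : X × ℝ).1 (5 * (p : X × ℝ).2)) := by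
        gcongr with p
        refine (setLIntegral_le_lintegral _ _).trans ?_
        rw [lintegral_indicator measurableSet_ball]
        have := (hu p p.2).1
        exact hG _ _ (by positivity)
    _ = stopJump Cd A * μ (ball z r) +
          G / 2 * (2 * ∑' p : u, μ (ball (p : X × ℝ).1 (5 * (p : X × ℝ).2))) := by
        rw [ENNReal.tsum_mul_left, ← mul_assoc, ENNReal.div_mul_cancel two_ne_zero (by simp)]
    _ ≤ stopJump Cd A * μ (ball z r) + G / 2 * μ (ball z r) := by gcongr
    _ = _ := by ring

lemma OscLE.setLIntegral_oscMaximal_le [SecondCountableTopology X] (hf : OscLE μ f A)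
    (h : IsDoublingWith μ Cd) (hA₀ : A ≠ 0) (hA : A ≠ ∞) (z : X) {r : ℝ} (hr : 0 < r) :
    ∫⁻ x in ball z r, oscMaximal μ f z r x ∂μ ≤ 2 * stopJump Cd A * μ (ball z r) := by
  have key : ∀ N : ℕ, ∀ z r, 0 < r → ∫⁻ x in ball z r, min (oscMaximal μ f z r x) N ∂μ ≤
      2 * stopJump Cd A * μ (ball z r) := by
    intro N
    let G : ℝ≥0∞ := ⨆ (z : X) (r : ℝ) (_ : 0 < r),
      ⨍⁻ x in ball z r, min (oscMaximal μ f z r x) N ∂μ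
    -- Truncation makes `G` finite, which allows `G / 2` to be subtracted below.
    have hGN : G ≤ N := iSup₂_le fun z r => iSup_le fun hr => by
      refine (lintegral_mono fun x => min_le_right _ _).trans_eq ?_
      exact setLAverage_const (h.measure_ball_ne_zero z hr) (h.measure_ball_ne_top z r) _
    have hG : ∀ z r, 0 < r →
        ∫⁻ x in ball z r, min (oscMaximal μ f z r x) N ∂μ ≤ G * μ (ball z r) := by
      intro z r hr
      rw [← measure_mul_setLAverage _ (h.measure_ball_ne_top z r), mul_comm]
      gcongr
      exact le_iSup₂_of_le z r (le_iSup_of_le hr le_rfl)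
    have hG2 : G ≤ stopJump Cd A + G / 2 := iSup₂_le fun z r => iSup_le fun hr => by
      rw [setLAverage_eq]
      exact ENNReal.div_le_of_le_mul
        (hf.setLIntegral_min_oscMaximal_le h hA₀ hA N G hG z hr)
    have hGt : G ≠ ∞ := ne_top_of_le_ne_top (ENNReal.natCast_ne_top N) hGN
    have hhalf : G / 2 ≤ stopJump Cd A := by
      have h2 : G / 2 ≠ ∞ := (ENNReal.div_lt_top hGt two_ne_zero).ne
      refine (ENNReal.add_le_add_iff_right h2).1 ?_
      rwa [ENNReal.add_halves]
    have hGle : G ≤ 2 * stopJump Cd A := by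
      rw [← ENNReal.add_halves G, two_mul]
      gcongr
    intro z r hr
    exact (hG z r hr).trans (by gcongr)
  have hsup : ∀ x, oscMaximal μ f z r x = ⨆ N : ℕ, min (oscMaximal μ f z r x) N := by
    intro x
    rw [← inf_iSup_eq, ENNReal.iSup_natCast, inf_top_eq]
  rw [lintegral_congr hsup, lintegral_iSup (fun N => (measurable_oscMaximal z r).min measurable_const)
    (fun M N hMN x => min_le_min_left _ (by exact_mod_cast hMN))]
  exact iSup_le fun N => key N z r hr

end Oscillation

/-! ### From the local bound to the maximal function -/

section MaximalBLO

variable {X : Type*} [MetricSpace X] [MeasurableSpace X] {μ : Measure X}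
  {Cd : ℝ} {f : X → ℝ} {A : ℝ≥0∞}

lemma OscLE.setLAverage_enorm_le (hf : OscLE μ f A) (h : IsDoublingWith μ Cd) {z w y : X}
    {r s : ℝ} (hr : 0 < r) (hs : 0 < s) (hy : y ∈ ball z r) :
    ⨍⁻ x in ball w s, ‖f x‖ₑ ∂μ ≤
      (⨍⁻ x in ball w s, ‖f x - ballAvg μ f z r‖ₑ ∂μ) + maximalFn μ f y := by
  have h1 := setLAverage_enorm_sub_le f (h.measure_ball_ne_zero w hs) (h.measure_ball_ne_top w s)
    0 (ballAvg μ f z r)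
  have h2 := enorm_setAverage_sub_le (hf z r hr).1 (h.measure_ball_ne_zero z hr)
    (h.measure_ball_ne_top z r) 0
  simp only [sub_zero] at h1 h2
  refine h1.trans ?_
  gcongr
  exact h2.trans (setLAverage_le_maximalFn f hr hy)

/-- The pointwise comparison of the maximal function at two points of a ball. -/
lemma OscLE.maximalFn_le_add (hf : OscLE μ f A) (h : IsDoublingWith μ Cd) {z x y : X} {r : ℝ}
    (hx : x ∈ ball z r) (hy : y ∈ ball z r) :
    maximalFn μ f x ≤ oscMaximal μ f z r x + (maximalFn μ f y + ENNReal.ofReal Cd ^ 2 * A) := by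
  have hr : 0 < r := pos_of_mem_ball hx
  refine maximalFn_le fun w s hs hxw => ?_
  rcases le_or_gt s r with hsr | hsr
  · refine (hf.setLAverage_enorm_le h hr hs hy).trans ?_
    exact add_le_add (le_maximalUpTo _ hs hsr hxw) le_self_add
  · have h4 : 0 < 4 * s := by positivity
    -- The distance from `y` to `w` is less than `r + r + s`, which is below `3 * s`.
    have hyw : y ∈ ball w (4 * s) := by
      have h1 := dist_triangle y z w
      have h2 := dist_triangle_left z w x
      rw [mem_ball] at *
      linarith
    refine ((hf.setLAverage_enorm_le h h4 hs hyw).trans ?_).trans le_add_self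
    rw [add_comm]
    gcongr
    refine (h.setLAverage_ball_le _ (z := w) (r := 4 * s) hs 2 (by rw [dist_self]; linarith)
      (ball_subset_ball (by linarith))).trans ?_
    gcongr
    exact (hf w _ h4).2

/-- The constant in the bound for the maximal function. -/
noncomputable def bloConst (Cd : ℝ) : ℝ :=
  Cd ^ 2 + 2 * (2 * (Cd ^ 5 * (1 + Cd ^ 2)) + (Cd ^ 3 + Cd ^ 4))

lemma bloConst_pos (hCd : 0 < Cd) : 0 < bloConst Cd := by
  unfold bloConst; positivity

lemma ofReal_bloConst_mul (hCd : 0 < Cd) :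
    ENNReal.ofReal (bloConst Cd) * A = 2 * stopJump Cd A + ENNReal.ofReal Cd ^ 2 * A := by
  have : ENNReal.ofReal (bloConst Cd) = ENNReal.ofReal Cd ^ 2 +
      2 * (2 * (ENNReal.ofReal Cd ^ 5 * (1 + ENNReal.ofReal Cd ^ 2)) +
        (ENNReal.ofReal Cd ^ 3 + ENNReal.ofReal Cd ^ 4)) := by
    lift Cd to NNReal using hCd.le
    have : bloConst (Cd : ℝ) = ((Cd ^ 2 + 2 * (2 * (Cd ^ 5 * (1 + Cd ^ 2)) +
      (Cd ^ 3 + Cd ^ 4)) : NNReal) : ℝ) := by simp [bloConst]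
    rw [this, ENNReal.ofReal_coe_nnreal, ENNReal.ofReal_coe_nnreal]
    push_cast
    rfl
  rw [this, stopJump, stopHeight]
  ring

variable [OpensMeasurableSpace X] [SecondCountableTopology X]

lemma OscLE.setLAverage_maximalFn_le (hf : OscLE μ f A) (h : IsDoublingWith μ Cd)
    (hA : A ≠ ∞) {z y : X} {r : ℝ} (hy : y ∈ ball z r) :
    ⨍⁻ x in ball z r, maximalFn μ f x ∂μ ≤
      maximalFn μ f y + ENNReal.ofReal (bloConst Cd) * A := by
  have hr : 0 < r := pos_of_mem_ball hy
  have hCd : 0 < Cd := by linarith [h.1]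
  have hz := h.measure_ball_ne_zero z hr
  have ht := h.measure_ball_ne_top z r
  -- `A` may vanish, while the stopping argument needs a positive bound; hence any `B ≥ A` is used
  -- and then `B` tends to `A`.
  have key : ∀ B : ℝ≥0∞, B ≠ 0 → B ≠ ∞ → A ≤ B → ⨍⁻ x in ball z r, maximalFn μ f x ∂μ ≤
      maximalFn μ f y + ENNReal.ofReal (bloConst Cd) * B := by
    intro B hB₀ hB hAB
    have hf' : OscLE μ f B := fun z r hr => ⟨(hf z r hr).1, (hf z r hr).2.trans hAB⟩
    calc _ ≤ ⨍⁻ x in ball z r,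
          (oscMaximal μ f z r x + (maximalFn μ f y + ENNReal.ofReal Cd ^ 2 * B)) ∂μ := by
          rw [setLAverage_eq, setLAverage_eq]
          gcongr ?_ / _
          exact setLIntegral_mono' measurableSet_ball fun x hx => hf'.maximalFn_le_add h hx hy
      _ = (⨍⁻ x in ball z r, oscMaximal μ f z r x ∂μ) +
          (maximalFn μ f y + ENNReal.ofReal Cd ^ 2 * B) := setLAverage_add_const_le _ hz ht _
      _ ≤ 2 * stopJump Cd B + (maximalFn μ f y + ENNReal.ofReal Cd ^ 2 * B) := by
          gcongr
          rw [setLAverage_eq]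
          exact ENNReal.div_le_of_le_mul (hf'.setLIntegral_oscMaximal_le h hB₀ hB z hr)
      _ = _ := by rw [ofReal_bloConst_mul hCd]; ring
  have hC := bloConst_pos hCd
  refine ENNReal.le_of_forall_pos_le_add fun ε hε _ => ?_
  have hC₀ : ENNReal.ofReal (bloConst Cd) ≠ 0 := by simpa using hC
  have hε' : (ε : ℝ≥0∞) / ENNReal.ofReal (bloConst Cd) ≠ 0 :=
    (ENNReal.div_pos (by exact_mod_cast hε.ne') ENNReal.ofReal_ne_top).ne'
  refine (key (A + ε / ENNReal.ofReal (bloConst Cd)) (by simp [hε'])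
    (ENNReal.add_ne_top.2 ⟨hA, (ENNReal.div_lt_top ENNReal.coe_ne_top hC₀).ne⟩)
    le_self_add).trans_eq ?_
  rw [mul_add, ENNReal.mul_div_cancel hC₀ ENNReal.ofReal_ne_top, add_assoc]

end MaximalBLO

/-! ### The extended-real norms -/

section Norms

variable {X : Type*} [MetricSpace X] [MeasurableSpace X] {μ : Measure X} {Cd : ℝ} {f : X → ℝ}

/-- Nonemptiness matters: the supremum over no balls would be `⊥`. -/
lemma exists_bmoNorm_eq_coe [Nonempty X] (hf : bmoNorm μ f < ⊤) :
    ∃ b : ℝ, 0 ≤ b ∧ bmoNorm μ f = b := by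
  have h0 : 0 ≤ bmoNorm μ f := by
    refine le_iSup₂_of_le (Classical.arbitrary X) 1 (le_iSup_of_le one_pos ?_)
    rw [setAverage_eq, smul_eq_mul]
    exact EReal.coe_nonneg.2 (by positivity)
  lift bmoNorm μ f to ℝ using ⟨hf.ne, (EReal.bot_lt_zero.trans_le h0).ne'⟩ with b
  exact ⟨b, EReal.coe_nonneg.1 h0, rfl⟩

lemma MemL1loc.integrableOn_ball [ProperSpace X] (hf : MemL1loc μ f) (z : X) (r : ℝ) :
    IntegrableOn f (ball z r) μ :=
  (hf _ (isCompact_closedBall z r)).mono_set ball_subset_closedBall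

lemma oscLE_of_bmoNorm_le [ProperSpace X] (h : IsDoublingWith μ Cd) (hf : MemL1loc μ f) {b : ℝ}
    (hb : bmoNorm μ f ≤ b) : OscLE μ f (ENNReal.ofReal b) := by
  intro z r hr
  have hi := hf.integrableOn_ball z r
  refine ⟨hi, ?_⟩
  have hi' : IntegrableOn (fun x => |f x - ballAvg μ f z r|) (ball z r) μ :=
    (hi.sub (integrableOn_const (h.measure_ball_ne_top z r))).abs
  have hle : (⨍ x in ball z r, |f x - ballAvg μ f z r| ∂μ) ≤ b :=
    EReal.coe_le_coe_iff.1 <| le_trans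
      (le_iSup₂_of_le z r (le_iSup_of_le hr le_rfl) : _ ≤ bmoNorm μ f) hb
  simp_rw [Real.enorm_eq_ofReal_abs]
  rw [setLAverage_eq, ← ofReal_setAverage hi' (ae_of_all _ fun _ => abs_nonneg _)]
  exact ENNReal.ofReal_le_ofReal hle

end Norms

/-! ### The main theorem -/

theorem mainTheorem9 (Cd : ℝ) (hCd : 1 < Cd) :
    ∃ C : ℝ, 0 < C ∧
      ∀ (X : Type*) [MetricSpace X] [CompleteSpace X] [MeasurableSpace X] [BorelSpace X]
        (μ : Measure X),
        IsDoublingWith μ Cd → AnnularDecay μ →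
        ∀ f : X → ℝ, MemBMO μ f → (∃ x : X, maximalFn μ f x < ∞) →
          (∀ᵐ x ∂μ, maximalFn μ f x < ∞) ∧
          MemBLO μ (fun x => (maximalFn μ f x).toReal) ∧
          bloNorm μ (fun x => (maximalFn μ f x).toReal) ≤ (C : EReal) * bmoNorm μ f := by
  have hC := bloConst_pos (Cd := Cd) (by linarith)
  refine ⟨bloConst Cd, hC, ?_⟩
  intro X _ _ _ _ μ h _ f hf ⟨x₀, hx₀⟩
  have := h.properSpace
  have : Nonempty X := ⟨x₀⟩
  obtain ⟨b, hb0, hb⟩ := exists_bmoNorm_eq_coe hf.2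
  have hosc := oscLE_of_bmoNorm_le h hf.1 hb.le
  have hmeas := measurable_maximalFn (μ := μ) f
  have havg : ∀ {z y : X} {r : ℝ}, y ∈ ball z r → ⨍⁻ x in ball z r, maximalFn μ f x ∂μ ≤
      maximalFn μ f y + ENNReal.ofReal (bloConst Cd * b) := fun hy => by
    rw [ENNReal.ofReal_mul hC.le]
    exact hosc.setLAverage_maximalFn_le h ENNReal.ofReal_ne_top hy
  have hfin : ∀ z r, ∫⁻ x in ball z r, maximalFn μ f x ∂μ ≠ ∞ := by
    intro z r
    -- Every ball lies in one containing `x₀`, where finiteness of the maximal function bounds the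
    -- average.
    have hsub : ball z r ⊆ ball x₀ (max r 0 + dist z x₀ + 1) :=
      ball_subset_ball' (by linarith [le_max_left r 0])
    have hmem : x₀ ∈ ball x₀ (max r 0 + dist z x₀ + 1) := mem_ball_self (by positivity)
    refine ne_top_of_le_ne_top ?_ (lintegral_mono_set hsub)
    rw [← measure_mul_setLAverage _ (h.measure_ball_ne_top _ _)]
    exact ENNReal.mul_ne_top (h.measure_ball_ne_top _ _) (ne_top_of_le_ne_top
      (ENNReal.add_ne_top.2 ⟨hx₀.ne, ENNReal.ofReal_ne_top⟩) (havg hmem))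
  have hae : ∀ᵐ x ∂μ, maximalFn μ f x < ∞ := by
    have hn : ∀ᵐ x ∂μ, ∀ n : ℕ, x ∈ ball x₀ n → maximalFn μ f x < ∞ := ae_all_iff.2 fun n =>
      (ae_restrict_iff' measurableSet_ball).1 (ae_lt_top hmeas (hfin x₀ n))
    filter_upwards [hn] with x hx
    obtain ⟨n, hn⟩ := exists_nat_gt (dist x x₀)
    exact hx n hn
  have hL1 : MemL1loc μ (fun x => (maximalFn μ f x).toReal) := by
    intro K hK
    obtain ⟨r, hr⟩ := hK.isBounded.subset_ball x₀
    exact IntegrableOn.mono_set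
      (integrable_toReal_of_lintegral_ne_top hmeas.aemeasurable (hfin x₀ r)) hr
  have hblo : bloNorm μ (fun x => (maximalFn μ f x).toReal) ≤ ((bloConst Cd * b : ℝ) : EReal) := by
    refine iSup₂_le fun z r => iSup_le fun hr => ?_
    refine EReal.sub_le_of_le_add ?_
    set q := ⨍ x in ball z r, (maximalFn μ f x).toReal ∂μ with hq
    -- The bound `havg` holds for every `y` in the ball, so its average passes below the essential
    -- infimum.
    have hle : ((q - bloConst Cd * b : ℝ) : EReal) ≤
        essInf (fun x => ((maximalFn μ f x).toReal : EReal)) (μ.restrict (ball z r)) := by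
      refine le_essInf_of_ae_le _ ?_
      filter_upwards [ae_restrict_mem measurableSet_ball, ae_restrict_of_ae hae] with y hy hyt
      rw [EReal.coe_le_coe_iff, sub_le_iff_le_add, hq,
        ← toReal_setLAverage hmeas.aemeasurable (ae_restrict_of_ae (hae.mono fun _ hx => hx.ne))]
      have := ENNReal.toReal_mono
        (ENNReal.add_ne_top.2 ⟨hyt.ne, ENNReal.ofReal_ne_top⟩) (havg hy)
      rwa [ENNReal.toReal_add hyt.ne ENNReal.ofReal_ne_top,
        ENNReal.toReal_ofReal (by positivity)] at this
    calc (q : EReal) = ((bloConst Cd * b : ℝ) : EReal) + ((q - bloConst Cd * b : ℝ) : EReal) := by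
          rw [← EReal.coe_add]; congr 1; ring
      _ ≤ _ := by gcongr
  refine ⟨hae, ⟨hL1, hblo.trans_lt (EReal.coe_lt_top _)⟩, ?_⟩
  rw [hb, ← EReal.coe_mul]
  exact hblo
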